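/- For a real Banach space $E$ let $B_E$, $S_E$ denote its closed unit ball and unit sphere, and $E^*$ its dual. For $B\subset B_E$, $A\subset S_{E^*}$ and a real number $r$, say that $B$ *$r$-norms* $A$ if for every $x^*\in A$ there is $x\in B$ with $x^*(x)\ge r$, and that $B$ *norms* $A$ if it $r$-norms $A$ for all $r\in(0,1)$. Let $\kappa$ be an infinite cardinal. - $E$ has the $\mathrm{SSD2P}_\kappa$ (symmetric strong diameter two property at $\kappa$) if for every $A\subset S_{E^*}$ with $|A|<\kappa$ and every $\varepsilon>0$ there are a set $B\subset B_E$ which $(1-\varepsilon)$-norms $A$ and $y\in B_E$ with $\|y\|\ge 1-\varepsilon$ and $x\pm y\in B_E$ for all $x\in B$. - $E$ has the $\mathrm{ASSD2P}_\kappa$ (the attaining version) if for every $A\subset S_{E^*}$ with $|A|<\kappa$ there are a set $B\subset S_E$ which norms $A$ and $y\in S_E$ with $x\pm y\in S_E$ for all $x\in B$. For a topological space $X$ put $$\mathrm{dens}(X)=\min\{|D|: D\subset X \text{ dense}\}+\aleph_0,\qquad c(X)=\sup\{|\mathcal C|:\mathcal C\text{ a family of mutually disjoint open subsets of }X\}+\aleph_0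 .$$ **Theorem.** Let $X$ be a locally compact $T_4$ (that is, normal and $T_1$) space, and let $C_0(X)$ be the real Banach space of continuous functions $X\to\mathbb R$ vanishing at infinity, with the supremum norm. (i) $C_0(X)$ fails the $\mathrm{SSD2P}_{\kappa}$ for $\kappa=\mathrm{dens}(X)^+$, the successor cardinal of $\mathrm{dens}(X)$. (ii) If $c(X)>\aleph_0$, then $C_0(X)$ has the $\mathrm{ASSD2P}_{c(X)}$. -/

import Mathlib

open scoped Cardinal ZeroAtInfty

namespace TransfiniteSSD2P

universe u

section BanachSpaces

variable {E : Type u} [NormedAddCommGroup E] [NormedSpace ℝ E]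

/-- `B` `r`-norms `A`: every functional in `A` takes a value at least `r` at some point of `B`.
It is used for subsets `B` of the unit ball of `E` and `A` of the dual unit sphere. -/
def RNorms (r : ℝ) (B : Set E) (A : Set (StrongDual ℝ E)) : Prop :=
  ∀ φ ∈ A, ∃ x ∈ B, r ≤ φ x

/-- `B` norms `A`: it `r`-norms `A` for all `r` in `(0, 1)`. -/
def Norms (B : Set E) (A : Set (StrongDual ℝ E)) : Prop :=
  ∀ r ∈ Set.Ioo (0 : ℝ) 1, RNorms r B A

variable (E) in
/-- The symmetric strong diameter two property at the cardinal `κ`. -/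
def HasSSD2P (κ : Cardinal.{u}) : Prop :=
  ∀ A : Set (StrongDual ℝ E), A ⊆ Metric.sphere 0 1 → #A < κ → ∀ ε : ℝ, 0 < ε →
    ∃ B : Set E, B ⊆ Metric.closedBall 0 1 ∧ RNorms (1 - ε) B A ∧
      ∃ y ∈ Metric.closedBall (0 : E) 1,
        (∀ x ∈ B, x + y ∈ Metric.closedBall (0 : E) 1 ∧ x - y ∈ Metric.closedBall (0 : E) 1) ∧
        1 - ε ≤ ‖y‖

variable (E) in
/-- The attaining symmetric strong diameter two property at the cardinal `κ`. -/
def HasASSD2P (κ : Cardinal.{u}) : Prop :=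
  ∀ A : Set (StrongDual ℝ E), A ⊆ Metric.sphere 0 1 → #A < κ →
    ∃ B : Set E, B ⊆ Metric.sphere 0 1 ∧ Norms B A ∧
      ∃ y ∈ Metric.sphere (0 : E) 1,
        ∀ x ∈ B, x + y ∈ Metric.sphere (0 : E) 1 ∧ x - y ∈ Metric.sphere (0 : E) 1

end BanachSpaces

section CardinalFunctions

variable (X : Type u) [TopologicalSpace X]

/-- The density character: the least cardinality of a dense subset, plus `ℵ₀`. -/
noncomputable def density : Cardinal.{u} :=
  sInf {c : Cardinal.{u} | ∃ D : Set X, Dense D ∧ #D = c} + ℵ₀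

variable {X} in
/-- A cellular family: a family of mutually disjoint open sets. -/
def IsCellularFamily (C : Set (Set X)) : Prop :=
  (∀ U ∈ C, IsOpen U) ∧ C.PairwiseDisjoint id

/-- The cellularity: the supremum of the cardinalities of cellular families, plus `ℵ₀`. -/
noncomputable def cellularity : Cardinal.{u} :=
  sSup {c : Cardinal.{u} | ∃ C : Set (Set X), IsCellularFamily C ∧ #C = c} + ℵ₀

/-- The supremum in the definition of the cellularity is a supremum of a bounded set. -/
theorem bddAbove_cellular :
    BddAbove {c : Cardinal.{u} | ∃ C : Set (Set X), IsCellularFamily C ∧ #C = c} := by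
  refine ⟨#(Set X), ?_⟩
  rintro c ⟨C, -, rfl⟩
  exact Cardinal.mk_set_le C

end CardinalFunctions

end TransfiniteSSD2P

namespace TransfiniteSSD2P

universe u

variable {X : Type u} [TopologicalSpace X]

/-! For (i), test on the Dirac functionals at a dense set: wherever some `x` in `B` is nearly `1`,
the bounds on `x ± y` force `y` to be small, so `y` is small everywhere. For (ii), a functional
charges only countably many members of a disjoint family (`countable_charged`), so fewer than `c(X)`
functionals all ignore some nonempty open `U` (`exists_open_uncharged`). Put a bump `y` inside `U`;
any `f` can be cut off to vanish on the support of `y` without changing its value under these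
functionals. -/

theorem norm_le_iff_forall_apply {f : C₀(X, ℝ)} {c : ℝ} (hc : 0 ≤ c) :
    ‖f‖ ≤ c ↔ ∀ t, |f t| ≤ c := by
  rw [← ZeroAtInftyContinuousMap.norm_toBCF_eq_norm, BoundedContinuousFunction.norm_le hc]
  rfl

theorem abs_apply_le_norm (f : C₀(X, ℝ)) (t : X) : |f t| ≤ ‖f‖ :=
  (norm_le_iff_forall_apply (norm_nonneg f)).1 le_rfl t

/-- The Dirac functional at a point. -/
noncomputable def dirac (t : X) : StrongDual ℝ C₀(X, ℝ) :=
  LinearMap.mkContinuous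
    { toFun := fun f => f t
      map_add' := fun _ _ => rfl
      map_smul' := fun _ _ => rfl } 1 fun f => by
    simpa using abs_apply_le_norm f t

@[simp] theorem dirac_apply (t : X) (f : C₀(X, ℝ)) : dirac t f = f t := rfl

theorem norm_dirac_le (t : X) : ‖dirac t‖ ≤ 1 :=
  LinearMap.mkContinuous_norm_le _ zero_le_one _

/-- A function in `C₀(X, ℝ)` that is `1` on a compact set and has compact support in a given
neighbourhood of it. -/
theorem exists_bump [R1Space X] [LocallyCompactSpace X] {K V : Set X} (hK : IsCompact K)
    (hV : IsOpen V) (hKV : K ⊆ V) :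
    ∃ f : C₀(X, ℝ), (∀ t ∈ K, f t = 1) ∧ IsCompact (tsupport f) ∧ tsupport f ⊆ V ∧
      ∀ t, f t ∈ Set.Icc (0 : ℝ) 1 := by
  obtain ⟨f, hf1, hfc, hfV, hf⟩ := exists_continuousMap_one_of_isCompact_subset_isOpen hK hV hKV
  exact ⟨⟨f, HasCompactSupport.is_zero_at_infty hfc⟩, fun t ht => hf1 ht, hfc, hfV, hf⟩

theorem norm_eq_one_of_apply {f : C₀(X, ℝ)} (hf : ∀ t, |f t| ≤ 1) {p : X} (hp : f p = 1) :
    ‖f‖ = 1 :=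
  le_antisymm ((norm_le_iff_forall_apply zero_le_one).2 hf) <| by
    simpa [hp] using abs_apply_le_norm f p

theorem norm_dirac [R1Space X] [LocallyCompactSpace X] (t : X) : ‖dirac t‖ = 1 := by
  refine le_antisymm (norm_dirac_le t) ?_
  obtain ⟨f, hf1, -, -, hf⟩ := exists_bump (isCompact_singleton (x := t)) isOpen_univ
    (Set.subset_univ _)
  have h1 : f t = 1 := hf1 t rfl
  have hn : ‖f‖ = 1 := norm_eq_one_of_apply (fun s => abs_le.2 ⟨by linarith [(hf s).1], (hf s).2⟩) h1
  simpa [h1, hn] using (dirac t).le_opNorm f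

theorem exists_dense_mk_le_density : ∃ D : Set X, Dense D ∧ #D ≤ density X := by
  obtain ⟨D, hD, h⟩ := csInf_mem (s := {c : Cardinal.{u} | ∃ D : Set X, Dense D ∧ #D = c})
    ⟨_, Set.univ, dense_univ, rfl⟩
  exact ⟨D, hD, h.trans_le le_self_add⟩

theorem not_hasSSD2P_succ_density [R1Space X] [LocallyCompactSpace X] :
    ¬ HasSSD2P C₀(X, ℝ) (Order.succ (density X)) := by
  intro h
  obtain ⟨D, hD, hcard⟩ := exists_dense_mk_le_density (X := X)
  obtain ⟨B, -, hB, y, -, hy, hyn⟩ := h (dirac '' D)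
    (by rintro _ ⟨t, -, rfl⟩; simpa using norm_dirac t)
    -- Any `ε < 1/2` works: `|y| ≤ ε` on `D`, hence everywhere, contradicts `‖y‖ ≥ 1 - ε`.
    (Order.lt_succ_of_le (Cardinal.mk_image_le.trans hcard)) (1 / 4) (by norm_num)
  have key : ∀ t, |y t| ≤ 1 / 4 := by
    have hcl : IsClosed {t : X | |y t| ≤ 1 / 4} :=
      isClosed_le (map_continuous y).abs continuous_const
    intro t
    refine hcl.closure_subset_iff.2 (fun d hd => ?_) (hD t)
    obtain ⟨x, hxB, hx⟩ := hB (dirac d) ⟨d, hd, rfl⟩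
    obtain ⟨hp, hm⟩ := hy x hxB
    rw [mem_closedBall_zero_iff, norm_le_iff_forall_apply zero_le_one] at hp hm
    have hp := (abs_le.1 (hp d)).2
    have hm := (abs_le.1 (hm d)).2
    simp only [ZeroAtInftyContinuousMap.add_apply, ZeroAtInftyContinuousMap.sub_apply,
      dirac_apply] at hp hm hx
    change |y d| ≤ 1 / 4
    exact abs_le.2 ⟨by linarith, by linarith⟩
  linarith [(norm_le_iff_forall_apply (by norm_num)).2 key]

/-- Disjointly supported functions in the unit ball add up to a function in the unit ball. -/
theorem norm_sum_le_one {C : Set (Set X)} (hC : C.PairwiseDisjoint id) (f : C → C₀(X, ℝ))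
    (hf : ∀ U, ‖f U‖ ≤ 1) (hfU : ∀ U : C, ∀ t ∉ (U : Set X), f U t = 0) (s : Finset C) :
    ‖∑ U ∈ s, f U‖ ≤ 1 := by
  refine (norm_le_iff_forall_apply zero_le_one).2 fun t => ?_
  rw [← dirac_apply, map_sum]
  simp only [dirac_apply]
  by_cases h : ∃ U ∈ s, t ∈ (U : Set X)
  · obtain ⟨U, hU, htU⟩ := h
    rw [Finset.sum_eq_single_of_mem U hU]
    · exact (abs_apply_le_norm _ t).trans (hf U)
    · intro V _ hVU
      refine hfU V t fun htV => ?_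
      exact Set.disjoint_left.1 (hC V.2 U.2 (Subtype.coe_injective.ne hVU)) htV htU
  · push Not at h
    rw [Finset.sum_eq_zero fun U hU => hfU U t (h U hU)]
    simp

/-- A functional on `C₀(X, ℝ)` charges only countably many members of a disjoint family. -/
theorem countable_charged {C : Set (Set X)} (hC : C.PairwiseDisjoint id)
    (φ : StrongDual ℝ C₀(X, ℝ)) :
    {U : C | ∃ f : C₀(X, ℝ), (∀ t ∉ (U : Set X), f t = 0) ∧ φ f ≠ 0}.Countable := by
  -- Signs are chosen so that all values `φ (g U)` are nonnegative; their finite sums are then at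
  -- most `‖φ‖`, and a summable family has countable support.
  have key : ∀ U : C, ∃ g : C₀(X, ℝ), ‖g‖ ≤ 1 ∧ (∀ t ∉ (U : Set X), g t = 0) ∧ 0 ≤ φ g ∧
      ((∃ f : C₀(X, ℝ), (∀ t ∉ (U : Set X), f t = 0) ∧ φ f ≠ 0) → φ g ≠ 0) := by
    intro U
    by_cases h : ∃ f : C₀(X, ℝ), (∀ t ∉ (U : Set X), f t = 0) ∧ φ f ≠ 0
    · obtain ⟨f, hfU, hf⟩ : ∃ f : C₀(X, ℝ), (∀ t ∉ (U : Set X), f t = 0) ∧ 0 < φ f := by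
        obtain ⟨f, hfU, hf⟩ := h
        rcases hf.lt_or_gt with hf | hf
        · exact ⟨-f, fun t ht => by simp [hfU t ht], by simpa using hf⟩
        · exact ⟨f, hfU, hf⟩
      have hn : 0 < ‖f‖ := norm_pos_iff.2 fun h0 => by simp [h0] at hf
      have hpos : 0 < φ (‖f‖⁻¹ • f) := by
        rw [map_smul, smul_eq_mul]
        positivity
      refine ⟨‖f‖⁻¹ • f, ?_, fun t ht => by simp [hfU t ht], hpos.le, fun _ => hpos.ne'⟩
      rw [norm_smul, norm_inv, norm_norm, inv_mul_cancel₀ hn.ne']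
    · exact ⟨0, by simp, by simp, by simp, fun h' => absurd h' h⟩
  choose g hg1 hgU hg0 hg using key
  have hs : Summable fun U => φ (g U) := by
    refine summable_of_sum_le (c := ‖φ‖) hg0 fun s => ?_
    rw [← map_sum]
    exact (le_abs_self _).trans (φ.unit_le_opNorm _ (norm_sum_le_one hC g hg1 hgU s))
  exact hs.countable_support.mono fun U hU => hg U hU

/-- The supremum need not be attained, but anything strictly below it is exceeded by one family;
uncountability makes the `+ ℵ₀` harmless. -/
theorem exists_cellular_of_lt_cellularity {κ : Cardinal.{u}} (hκ : κ < cellularity X)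
    (hX : ℵ₀ < cellularity X) :
    ∃ C : Set (Set X), IsCellularFamily C ∧ κ < #C ∧ ℵ₀ < #C := by
  have hmax : max κ ℵ₀ < sSup {c : Cardinal.{u} | ∃ C : Set (Set X), IsCellularFamily C ∧ #C = c} := by
    have h := max_lt hκ hX
    rw [cellularity, Cardinal.add_eq_max' le_rfl] at h
    exact (lt_max_iff.1 h).resolve_right (le_max_right _ _).not_gt
  obtain ⟨_, ⟨C, hC, rfl⟩, h⟩ := exists_lt_of_lt_csSup' hmax
  exact ⟨C, hC, (le_max_left _ _).trans_lt h, (le_max_right _ _).trans_lt h⟩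

/-- Fewer than `c(X)` functionals leave some nonempty open set uncharged. -/
theorem exists_open_uncharged (hX : ℵ₀ < cellularity X) {A : Set (StrongDual ℝ C₀(X, ℝ))}
    (hA : #A < cellularity X) :
    ∃ U : Set X, IsOpen U ∧ U.Nonempty ∧
      ∀ φ ∈ A, ∀ f : C₀(X, ℝ), (∀ t ∉ U, f t = 0) → φ f = 0 := by
  obtain ⟨C, ⟨hCo, hCd⟩, hAC, hC⟩ := exists_cellular_of_lt_cellularity hA hX
  let bad (φ : StrongDual ℝ C₀(X, ℝ)) : Set C :=
    {U : C | ∃ f : C₀(X, ℝ), (∀ t ∉ (U : Set X), f t = 0) ∧ φ f ≠ 0}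
  -- A cellular family may contain the empty set, which must be avoided too.
  let E : Set C := {U : C | (U : Set X) = ∅}
  have hE : #E < #C := by
    have : E.Subsingleton := fun U hU V hV => Subtype.ext (hU.trans hV.symm)
    exact (Cardinal.le_aleph0_iff_set_countable.2 this.countable).trans_lt hC
  have hbad : #(⋃ φ ∈ A, bad φ : Set C) < #C := by
    refine (Cardinal.mk_biUnion_le bad A).trans_lt ?_
    refine (mul_le_mul_right (ciSup_le' fun φ : A =>
      Cardinal.le_aleph0_iff_set_countable.2 (countable_charged hCd φ.1)) _).trans_lt ?_
    exact Cardinal.mul_lt_of_lt hC.le hAC hC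
  have hne : ((⋃ φ ∈ A, bad φ) ∪ E) ≠ Set.univ := by
    intro h
    have := (Cardinal.mk_union_le (⋃ φ ∈ A, bad φ) E).trans_lt
      (Cardinal.add_lt_of_lt hC.le hbad hE)
    rw [h, Cardinal.mk_univ] at this
    exact this.false
  obtain ⟨U, hU⟩ := (Set.ne_univ_iff_exists_notMem _).1 hne
  rw [Set.mem_union, not_or] at hU
  refine ⟨U, hCo U U.2, Set.nonempty_iff_ne_empty.2 hU.2, fun φ hφ f hf => ?_⟩
  by_contra h
  exact hU.1 (Set.mem_biUnion hφ ⟨f, hf, h⟩)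

/-- Adding disjointly supported functions in the unit ball, one of which has norm one,
gives a function of norm one. -/
theorem norm_add_eq_one_of_disjoint {x y : C₀(X, ℝ)} (hx : ‖x‖ = 1) (hy : ‖y‖ ≤ 1)
    (h : ∀ t, x t = 0 ∨ y t = 0) : ‖x + y‖ = 1 := by
  apply le_antisymm
  · refine (norm_le_iff_forall_apply zero_le_one).2 fun t => ?_
    rcases h t with h | h
    · simpa [h] using (abs_apply_le_norm y t).trans hy
    · simpa [h] using (abs_apply_le_norm x t).trans hx.le
  · rw [← hx]
    refine (norm_le_iff_forall_apply (norm_nonneg _)).2 fun t => ?_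
    rcases h t with h' | h'
    · simp [h']
    · simpa [h'] using abs_apply_le_norm (x + y) t

theorem exists_norm_one_lt_apply {φ : StrongDual ℝ C₀(X, ℝ)} {r : ℝ} (hr : r < ‖φ‖) :
    ∃ f : C₀(X, ℝ), ‖f‖ ≤ 1 ∧ r < φ f := by
  obtain ⟨f, hf1, hf⟩ := φ.exists_lt_apply_of_lt_opNorm hr
  rcases lt_max_iff.1 (hf : r < |φ f|) with h | h
  · exact ⟨f, hf1.le, h⟩
  · exact ⟨-f, by simpa using hf1.le, by simpa using h⟩

theorem hasASSD2P_cellularity [R1Space X] [LocallyCompactSpace X] (hX : ℵ₀ < cellularity X) :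
    HasASSD2P C₀(X, ℝ) (cellularity X) := by
  intro A hA hcard
  obtain ⟨U, hUo, ⟨p, hp⟩, hU⟩ := exists_open_uncharged hX hcard
  obtain ⟨y, hyp, hyc, hyU, hy⟩ := exists_bump (isCompact_singleton (x := p)) hUo (by simpa using hp)
  -- With `h = 1` on the support of `y` and `h` supported in `U`, `f - f * h` is disjoint from `y`,
  -- while `f * h` is killed by `A`.
  obtain ⟨h, hh1, -, hhU, hh⟩ := exists_bump hyc hUo hyU
  have hyn : ‖y‖ = 1 := norm_eq_one_of_apply
    (fun t => abs_le.2 ⟨by linarith [(hy t).1], (hy t).2⟩) (hyp p rfl)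
  refine ⟨{x | ‖x‖ = 1 ∧ ∀ t, x t = 0 ∨ y t = 0}, fun x hx => by simpa using hx.1, ?_, y,
    by simpa using hyn, fun x hx => ⟨?_, ?_⟩⟩
  · intro r hr φ hφ
    obtain ⟨f, hf1, hf⟩ := exists_norm_one_lt_apply (φ := φ) (r := r)
      (by rw [mem_sphere_zero_iff_norm.1 (hA hφ)]; exact hr.2)
    let g : C₀(X, ℝ) := f - f * h
    have hgt (t : X) : g t = f t * (1 - h t) := by
      simp only [g, ZeroAtInftyContinuousMap.sub_apply, ZeroAtInftyContinuousMap.mul_apply]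
      ring
    have hg1 : ‖g‖ ≤ 1 := by
      refine (norm_le_iff_forall_apply zero_le_one).2 fun t => ?_
      rw [hgt, abs_mul]
      exact mul_le_one₀ ((abs_apply_le_norm f t).trans hf1) (abs_nonneg _)
        (abs_le.2 ⟨by linarith [(hh t).2], by linarith [(hh t).1]⟩)
    have hφg : φ g = φ f := by
      rw [map_sub, hU φ hφ (f * h), sub_zero]
      intro t ht
      simp [image_eq_zero_of_notMem_tsupport fun h' => ht (hhU h')]
    have hgpos : 0 < φ g := by rw [hφg]; exact hr.1.trans hf
    have hn : 0 < ‖g‖ := norm_pos_iff.2 fun h0 => by simp [h0] at hgpos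
    refine ⟨‖g‖⁻¹ • g, ⟨?_, fun t => ?_⟩, ?_⟩
    · rw [norm_smul, norm_inv, norm_norm, inv_mul_cancel₀ hn.ne']
    · by_cases ht : t ∈ tsupport y
      · left
        simp [hgt, hh1 t ht]
      · exact Or.inr (image_eq_zero_of_notMem_tsupport ht)
    · rw [map_smul, smul_eq_mul]
      refine (hf.trans_eq hφg.symm).le.trans ?_
      -- Since `‖g‖ ≤ 1` and `φ g > 0`, normalizing can only increase the value.
      exact le_mul_of_one_le_left hgpos.le ((one_le_inv₀ hn).2 hg1)
  · simpa using norm_add_eq_one_of_disjoint hx.1 hyn.le hx.2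
  · rw [mem_sphere_zero_iff_norm, sub_eq_add_neg]
    exact norm_add_eq_one_of_disjoint hx.1 (by simpa using hyn.le) (by simpa using hx.2)

end TransfiniteSSD2P

theorem mainTheorem1 {X : Type*} [TopologicalSpace X] [T4Space X] [LocallyCompactSpace X] :
    ¬ TransfiniteSSD2P.HasSSD2P C₀(X, ℝ) (Order.succ (TransfiniteSSD2P.density X)) ∧
    (ℵ₀ < TransfiniteSSD2P.cellularity X →
      TransfiniteSSD2P.HasASSD2P C₀(X, ℝ) (TransfiniteSSD2P.cellularity X)) :=
  ⟨TransfiniteSSD2P.not_hasSSD2P_succ_density, TransfiniteSSD2P.hasASSD2P_cellularity⟩
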